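/- Let $\Delta=\{(s,t): 0\le s\le t<\infty\}$ and $\mathbb H=\{\zeta\in\mathbb C:\operatorname{Re}\zeta>0\}$. A function $f:(0,\infty)\to\mathbb R$ is a *Bernstein function* if it is $C^\infty$, $f\ge 0$ and $(-1)^{n-1}f^{(n)}\ge 0$ for all $n\ge 1$. A Bernstein function that does not vanish identically has a unique holomorphic extension $\mathbb H\to\mathbb H$, with which it is identified; $\mathsf{BF}$ denotes the set of all these holomorphic self-maps of $\mathbb H$. A *topological reverse evolution family* in $\mathbb H$ is a family $(v_{s,t})_{(s,t)\in\Delta}$ of holomorphic self-maps of $\mathbb H$ such that $v_{s,s}=\mathrm{id}_{\mathbb H}$ for all $s\ge 0$; $v_{s,u}=v_{s,t}\circ v_{t,u}$ for all $0\le s\le t\le u$; and $(s,t)\mapsto v_{s,t}$ is continuous on $\Delta$ with respect to locally uniform convergence in $\mathbb H$. A *family of transition kernels of a (time-inhomogeneous, continuous-state) branching process* is a family $(k_{s,t})_{(s,t)\in\Delta}$ of Borel probability kernels on the compact space $[0,\infty]$ such that - (K1) $k_{s,s}(x,\cdot)=\delta_x$ for all $s\ge 0$, $x\in[0,\infty]$;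 - (K2) $\int_{[0,\infty]}k_{t,u}(y,B)\,k_{s,t}(x,\mathrm dy)=k_{s,u}(x,B)$ for all $0\le s\le t\le u$, $x\in[0,\infty]$ and Borel $B\subset[0,\infty]$; - (K3) $(s,t,x)\mapsto k_{s,t}(x,\cdot)$ is weakly continuous from $\Delta\times[0,\infty)$ to the Borel probability measures on $[0,\infty]$; - (K4) $k_{s,t}(x,\cdot)*k_{s,t}(y,\cdot)=k_{s,t}(x+y,\cdot)$ for all $(s,t)\in\Delta$ and $x,y\in[0,\infty)$; - (K5) $k_{s,t}(0,\cdot)=\delta_0$ for all $(s,t)\in\Delta$; - (K6) $k_{s,t}(\infty,\cdot)=\delta_\infty$ for all $(s,t)\in\Delta$. A *Laplace exponent* of $k_{s,t}$ is a Bernstein function $v_{s,t}:(0,\infty)\to[0,\infty)$ such that $$\int_{[0,\infty)}e^{-\theta y}\,k_{s,t}(x,\mathrm dy)=e^{-x\,v_{s,t}(\theta)}\qquad\text{for all }x,\theta\in(0,\infty).\tag{1}$$ **Theorem.** Let $(k_{s,t})_{(s,t)\in\Delta}$ be a family of transition kernels of a branching process. Then every $k_{s,t}$ has a unique Laplace exponent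 $v_{s,t}$, and the (extensions to $\mathbb H$ of the) Laplace exponents form a topological reverse evolution family $(v_{s,t})_{(s,t)\in\Delta}$ contained in $\mathsf{BF}$. Conversely, for every topological reverse evolution family $(v_{s,t})_{(s,t)\in\Delta}$ contained in $\mathsf{BF}$ there exists a unique family $(k_{s,t})_{(s,t)\in\Delta}$ of transition kernels of a branching process such that (1) holds for all $(s,t)\in\Delta$. -/

import Mathlib

open MeasureTheory ProbabilityTheory
open scoped NNReal ENNReal

noncomputable section

/-- The set `Δ` of all pairs `(s, t)` of times with `0 ≤ s ≤ t`,
with the topology induced by the plane. -/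
abbrev TimePair : Type := {p : ℝ≥0 × ℝ≥0 // p.1 ≤ p.2}

/-- The pair `(s, t)`, for `s ≤ t`. -/
abbrev TimePair.mk' (s t : ℝ≥0) (h : s ≤ t) : TimePair := ⟨(s, t), h⟩

/-- `Hol(D, E)`: the holomorphic maps of `D` into `E`. As a subtype of `C(D, E)` it carries the
compact-open topology, i.e. the topology of locally uniform convergence in `D`
(for `D` open in the plane). -/
abbrev Hol (D E : Set ℂ) : Type :=
  {f : C(D, E) // ∃ F : ℂ → ℂ, DifferentiableOn ℂ F D ∧ ∀ z : D, F z = f z}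

/-- The open right half-plane. -/
def rightHalfPlane : Set ℂ := {z : ℂ | 0 < z.re}

/-- A positive real number as a point of the right half-plane. -/
def posToHalfPlane (θ : ℝ) (hθ : 0 < θ) : rightHalfPlane := ⟨(θ : ℂ), by
  simpa [rightHalfPlane] using hθ⟩

/-- Bernstein functions on `(0, ∞)` (the values of `f` outside `(0, ∞)` play no role). -/
structure IsBernstein (f : ℝ → ℝ) : Prop where
  smooth : ContDiffOn ℝ ((⊤ : ℕ∞) : WithTop ℕ∞) f (Set.Ioi 0)
  nonneg : ∀ θ : ℝ, 0 < θ → 0 ≤ f θ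
  deriv_sign : ∀ n : ℕ, 1 ≤ n → ∀ θ : ℝ, 0 < θ → 0 ≤ (-1 : ℝ) ^ (n - 1) * iteratedDeriv n f θ

/-- The holomorphic self-map `f` of the right half-plane extends `φ : (0, ∞) → ℝ`. -/
def IsHolExtension (f : Hol rightHalfPlane rightHalfPlane) (φ : ℝ → ℝ) : Prop :=
  ∀ (θ : ℝ) (hθ : 0 < θ), ((f.1 (posToHalfPlane θ hθ) : rightHalfPlane) : ℂ) = (φ θ : ℂ)

/-- The class `BF` of Bernstein functions that do not vanish identically, regarded as holomorphic
self-maps of the right half-plane. -/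
def BF : Set (Hol rightHalfPlane rightHalfPlane) :=
  {f | ∃ φ : ℝ → ℝ, IsBernstein φ ∧ (∃ θ : ℝ, 0 < θ ∧ φ θ ≠ 0) ∧ IsHolExtension f φ}

/-- Topological reverse evolution families in `D`. -/
structure IsTopologicalREF {D : Set ℂ} (v : TimePair → Hol D D) : Prop where
  refl : ∀ (s : ℝ≥0) (z : D), (v (TimePair.mk' s s le_rfl)).1 z = z
  comp : ∀ (s t u : ℝ≥0) (hst : s ≤ t) (htu : t ≤ u) (z : D),
    (v (TimePair.mk' s u (hst.trans htu))).1 z =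
      (v (TimePair.mk' s t hst)).1 ((v (TimePair.mk' t u htu)).1 z)
  continuous : Continuous v

/-- The probability measure `κ(x, ·)`; `ProbabilityMeasure` carries the topology of weak
convergence. -/
def kernelProb (κ : Kernel ℝ≥0∞ ℝ≥0∞) [IsMarkovKernel κ] (x : ℝ≥0∞) : ProbabilityMeasure ℝ≥0∞ :=
  ⟨κ x, inferInstance⟩

/-- Families of transition kernels of a (time-inhomogeneous, continuous-state) branching process
on `[0, ∞]`. -/
structure IsBranchingKernelFamily (k : TimePair → Kernel ℝ≥0∞ ℝ≥0∞) : Prop where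
  /-- All the measures `k_{s,t}(x, ·)` are probability measures. -/
  markov : ∀ p : TimePair, IsMarkovKernel (k p)
  refl : ∀ (s : ℝ≥0) (x : ℝ≥0∞), k (TimePair.mk' s s le_rfl) x = Measure.dirac x
  /-- Chapman-Kolmogorov equation: `∫ k_{t,u}(y, B) k_{s,t}(x, dy) = k_{s,u}(x, B)`. -/
  chapman_kolmogorov : ∀ (s t u : ℝ≥0) (hst : s ≤ t) (htu : t ≤ u) (x : ℝ≥0∞) (B : Set ℝ≥0∞),
    MeasurableSet B →
      ∫⁻ y, k (TimePair.mk' t u htu) y B ∂(k (TimePair.mk' s t hst) x) =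
        k (TimePair.mk' s u (hst.trans htu)) x B
  /-- Weak continuity of `(s, t, x) ↦ k_{s,t}(x, ·)` on `Δ × [0, ∞)`. -/
  weakly_continuous : Continuous fun q : TimePair × ℝ≥0 =>
    haveI := markov q.1
    kernelProb (k q.1) (q.2 : ℝ≥0∞)
  /-- Branching property, for `x, y` in `[0, ∞)`. -/
  branching : ∀ (p : TimePair) (x y : ℝ≥0),
    Measure.conv (k p (x : ℝ≥0∞)) (k p (y : ℝ≥0∞)) = k p ((x : ℝ≥0∞) + (y : ℝ≥0∞))
  zero_absorbing : ∀ p : TimePair, k p 0 = Measure.dirac 0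
  top_absorbing : ∀ p : TimePair, k p ∞ = Measure.dirac ∞

/-- The Bernstein function `φ` is a Laplace exponent of the kernel `κ` on `[0, ∞]`:
`∫_{[0, ∞)} exp(-θ y) κ(x, dy) = exp(-x φ(θ))` for all `x, θ` in `(0, ∞)`. -/
structure IsLaplaceExponent (κ : Kernel ℝ≥0∞ ℝ≥0∞) (φ : ℝ → ℝ) : Prop where
  bernstein : IsBernstein φ
  laplace : ∀ x θ : ℝ, 0 < x → 0 < θ →
    ∫ y in Set.Iio ∞, Real.exp (-θ * y.toReal) ∂(κ (ENNReal.ofReal x)) = Real.exp (-x * φ θ)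

end

/-! A probability measure on `[0, ∞]` is encoded by its Laplace transform, where `exp (-ζ y)` is
read as `0` at `y = ∞`. For `Re ζ > 0` this is a continuous function on a compact space. Hence the
transform determines the measure (Stone–Weierstrass, `ext_of_realLaplace_eq`) and depends
continuously on it. Since the probability measures on `[0, ∞]` form a compact space, pointwise
convergence of transforms conversely gives weak convergence
(`continuous_of_continuous_realLaplace`). Under this dictionary the branching property says that the
transform is exponential in `x`, and Chapman–Kolmogorov says that exponents compose.

From evolution families to kernels: if `φ` is Bernstein, then `exp (-x φ)` is completely monotone,
so Bernstein's theorem (`exists_realLaplace_eq`) supplies the measures. With `∞` added as a trap,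
every axiom becomes an identity or a continuity statement between transforms.

From kernels to evolution families: for fixed `(s, t, ζ)` the transform is a continuous
multiplicative semigroup in `x`, so it equals `exp (-x G)`, where `G` is locally a logarithm and
thus holomorphic in `ζ` and jointly continuous (`exists_semigroup_exponent`). Complete monotonicity
of `exp (-x φ)` for small `x` makes `φ` Bernstein. The delicate point is that `φ` never vanishes
(`exponent_pos`): a first time at which it degenerates would contradict continuity and `φ_{t,t} =
id`. Then `Re G(ζ) ≥ φ(Re ζ) > 0` keeps `G` in the half-plane, and the identity theorem carries the
composition law from the half-line to the half-plane. -/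

section

open Filter Set
open scoped Topology

/-! ### Laplace transforms of measures on `[0, ∞]` -/

/-- The function `y ↦ exp (-ζ y)` on `[0, ∞]`, with value `0` at `∞`. -/
noncomputable def laplaceKernel (ζ : ℂ) (y : ℝ≥0∞) : ℂ :=
  if y = ∞ then 0 else Complex.exp (-ζ * (y.toReal : ℂ))

/-- The Laplace transform of a measure on `[0, ∞]`. -/
noncomputable def laplace (μ : Measure ℝ≥0∞) (ζ : ℂ) : ℂ := ∫ y, laplaceKernel ζ y ∂μ

/-- The Laplace transform of a measure on `[0, ∞]`, as a function of a real variable. -/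
noncomputable def realLaplace (μ : Measure ℝ≥0∞) (θ : ℝ) : ℝ :=
  ∫ y in Set.Iio ∞, Real.exp (-θ * y.toReal) ∂μ

lemma isOpen_rightHalfPlane : IsOpen rightHalfPlane :=
  isOpen_lt continuous_const Complex.continuous_re

lemma ofReal_mem_rightHalfPlane {θ : ℝ} (hθ : 0 < θ) : (θ : ℂ) ∈ rightHalfPlane := by
  simpa [rightHalfPlane] using hθ

@[simp] lemma laplaceKernel_top (ζ : ℂ) : laplaceKernel ζ ∞ = 0 := if_pos rfl

lemma laplaceKernel_of_ne_top (ζ : ℂ) {y : ℝ≥0∞} (hy : y ≠ ∞) :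
    laplaceKernel ζ y = Complex.exp (-ζ * (y.toReal : ℂ)) := if_neg hy

@[simp] lemma laplaceKernel_coe (ζ : ℂ) (y : ℝ≥0) :
    laplaceKernel ζ y = Complex.exp (-ζ * (y : ℂ)) := by
  rw [laplaceKernel_of_ne_top _ ENNReal.coe_ne_top]; rfl

lemma norm_laplaceKernel_of_ne_top (ζ : ℂ) {y : ℝ≥0∞} (hy : y ≠ ∞) :
    ‖laplaceKernel ζ y‖ = Real.exp (-ζ.re * y.toReal) := by
  rw [laplaceKernel_of_ne_top _ hy, Complex.norm_exp]; simp

lemma norm_laplaceKernel_le_one {ζ : ℂ} (hζ : ζ ∈ rightHalfPlane) (y : ℝ≥0∞) :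
    ‖laplaceKernel ζ y‖ ≤ 1 := by
  by_cases hy : y = ∞
  · simp [hy]
  rw [norm_laplaceKernel_of_ne_top _ hy, Real.exp_le_one_iff]
  have : 0 < ζ.re := hζ
  have := mul_nonneg this.le (ENNReal.toReal_nonneg (a := y))
  linarith

lemma laplaceKernel_add (ζ : ℂ) (y z : ℝ≥0∞) :
    laplaceKernel ζ (y + z) = laplaceKernel ζ y * laplaceKernel ζ z := by
  induction y with
  | top => simp
  | coe y =>
    induction z with
    | top => simp
    | coe z =>
      rw [← ENNReal.coe_add]
      simp only [laplaceKernel_coe, ← Complex.exp_add]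
      congr 1; push_cast; ring

/-- Only the points at `y = ∞` are delicate. There `exp (-(Re ζ / 2) y)` dominates the kernel
uniformly for parameters near `ζ`; this uses `Re ζ > 0`. -/
lemma continuous_laplaceKernel :
    Continuous fun q : rightHalfPlane × ℝ≥0∞ => laplaceKernel q.1 q.2 := by
  rw [continuous_iff_continuousAt]
  rintro ⟨ζ, y⟩
  by_cases hy : y = ∞
  · subst hy
    rw [ContinuousAt, laplaceKernel_top, Metric.tendsto_nhds]
    intro ε hε
    have hζ : 0 < (ζ : ℂ).re := ζ.2
    have hc : Tendsto (fun r : ℝ => Real.exp (-((ζ : ℂ).re / 2) * r)) atTop (𝓝 0) := by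
      refine Real.tendsto_exp_atBot.comp (tendsto_id.const_mul_atTop_of_neg (by linarith))
    obtain ⟨R, hR⟩ := eventually_atTop.1 (hc.eventually (gt_mem_nhds hε))
    have h1 : ∀ᶠ q : rightHalfPlane × ℝ≥0∞ in 𝓝 (ζ, ∞), (ζ : ℂ).re / 2 < (q.1 : ℂ).re := by
      have : ContinuousAt (fun q : rightHalfPlane × ℝ≥0∞ => (q.1 : ℂ).re) (ζ, ∞) := by fun_prop
      exact this.eventually (lt_mem_nhds (by simp only; linarith))
    have h2 : ∀ᶠ q : rightHalfPlane × ℝ≥0∞ in 𝓝 (ζ, ∞), ENNReal.ofReal R < q.2 :=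
      continuousAt_snd.eventually (lt_mem_nhds ENNReal.ofReal_lt_top)
    filter_upwards [h1, h2] with q hq1 hq2
    rw [dist_zero_right]
    by_cases hq : q.2 = ∞
    · simpa [hq] using hε
    rw [norm_laplaceKernel_of_ne_top _ hq]
    refine lt_of_le_of_lt ?_ (hR q.2.toReal ((ENNReal.ofReal_le_iff_le_toReal hq).1 hq2.le))
    gcongr
  · have h : ∀ᶠ q : rightHalfPlane × ℝ≥0∞ in 𝓝 (ζ, y), q.2 ≠ ∞ :=
      continuousAt_snd.eventually (isOpen_ne.mem_nhds (show (ζ, y).2 ≠ ∞ from hy))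
    have h' : (fun q : rightHalfPlane × ℝ≥0∞ => Complex.exp (-q.1 * (q.2.toReal : ℂ)))
        =ᶠ[𝓝 (ζ, y)] fun q => laplaceKernel q.1 q.2 := by
      filter_upwards [h] with q hq
      rw [laplaceKernel_of_ne_top _ hq]
    refine ContinuousAt.congr ?_ h'
    have : ContinuousAt (fun q : rightHalfPlane × ℝ≥0∞ => q.2.toReal) (ζ, y) :=
      ContinuousAt.comp (f := Prod.snd) (g := ENNReal.toReal) (ENNReal.continuousAt_toReal hy)
        continuousAt_snd
    fun_prop

lemma continuous_laplaceKernel_right {ζ : ℂ} (hζ : ζ ∈ rightHalfPlane) :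
    Continuous (laplaceKernel ζ) :=
  continuous_laplaceKernel.comp (Continuous.prodMk_right (⟨ζ, hζ⟩ : rightHalfPlane))

lemma measurable_laplaceKernel (ζ : ℂ) : Measurable (laplaceKernel ζ) := by
  unfold laplaceKernel
  exact Measurable.ite (measurableSet_singleton ∞) measurable_const (by fun_prop)

lemma integrable_laplaceKernel (μ : Measure ℝ≥0∞) [IsFiniteMeasure μ] {ζ : ℂ}
    (hζ : ζ ∈ rightHalfPlane) : Integrable (laplaceKernel ζ) μ :=
  Integrable.of_bound (measurable_laplaceKernel ζ).aestronglyMeasurable 1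
    (ae_of_all _ (norm_laplaceKernel_le_one hζ))

lemma laplace_eq_setIntegral (μ : Measure ℝ≥0∞) (ζ : ℂ) :
    laplace μ ζ = ∫ y in Iio ∞, Complex.exp (-ζ * (y.toReal : ℂ)) ∂μ := by
  rw [← integral_indicator measurableSet_Iio, laplace]
  refine integral_congr_ae (ae_of_all _ fun y => ?_)
  by_cases hy : y = ∞ <;> simp [hy, laplaceKernel, indicator, lt_top_iff_ne_top]

/-- As a moment generating function of `-y` on `[0, ∞)`, the transform inherits holomorphy and
formulas for its derivatives. -/
lemma laplace_eq_complexMGF (μ : Measure ℝ≥0∞) (ζ : ℂ) :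
    laplace μ ζ = complexMGF (fun y : ℝ≥0∞ => -y.toReal) (μ.restrict (Iio ∞)) ζ := by
  rw [laplace_eq_setIntegral, complexMGF]
  simp

lemma realLaplace_eq_mgf (μ : Measure ℝ≥0∞) (θ : ℝ) :
    realLaplace μ θ = mgf (fun y : ℝ≥0∞ => -y.toReal) (μ.restrict (Iio ∞)) θ := by
  rw [realLaplace, mgf]
  simp

lemma laplace_ofReal (μ : Measure ℝ≥0∞) (θ : ℝ) : laplace μ θ = realLaplace μ θ := by
  rw [laplace_eq_complexMGF, complexMGF_ofReal, realLaplace_eq_mgf]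

lemma norm_laplace_le (μ : Measure ℝ≥0∞) (ζ : ℂ) : ‖laplace μ ζ‖ ≤ realLaplace μ ζ.re := by
  rw [laplace_eq_complexMGF, realLaplace_eq_mgf]
  exact norm_complexMGF_le_mgf

lemma Ioi_subset_interior_integrableExpSet (μ : Measure ℝ≥0∞) [IsFiniteMeasure μ] :
    Ioi 0 ⊆ interior (integrableExpSet (fun y : ℝ≥0∞ => -y.toReal) (μ.restrict (Iio ∞))) := by
  refine interior_maximal (fun θ (hθ : 0 < θ) => ?_) isOpen_Ioi
  refine Integrable.of_bound (by fun_prop) 1 (ae_of_all _ fun y => ?_)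
  rw [Real.norm_eq_abs, Real.abs_exp, Real.exp_le_one_iff]
  have := mul_nonneg hθ.le (ENNReal.toReal_nonneg (a := y))
  linarith

lemma differentiableOn_laplace (μ : Measure ℝ≥0∞) [IsFiniteMeasure μ] :
    DifferentiableOn ℂ (laplace μ) rightHalfPlane := by
  rw [show laplace μ = _ from funext (laplace_eq_complexMGF μ)]
  exact differentiableOn_complexMGF.mono fun z hz => Ioi_subset_interior_integrableExpSet μ hz

lemma iteratedDeriv_realLaplace_sign (μ : Measure ℝ≥0∞) [IsFiniteMeasure μ] (n : ℕ) {θ : ℝ}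
    (hθ : 0 < θ) : 0 ≤ (-1) ^ n * iteratedDeriv n (realLaplace μ) θ := by
  rw [show realLaplace μ = _ from funext (realLaplace_eq_mgf μ),
    iteratedDeriv_mgf (Ioi_subset_interior_integrableExpSet μ hθ), ← integral_const_mul]
  refine integral_nonneg fun y => ?_
  simp only [Pi.zero_apply]
  rw [← mul_assoc, ← mul_pow]
  have := ENNReal.toReal_nonneg (a := y)
  simp only [neg_mul, one_mul, neg_neg]
  positivity

/-- A probability measure on `[0, ∞]` is determined by its Laplace transform. -/
lemma ext_of_realLaplace_eq {μ ν : Measure ℝ≥0∞} [IsProbabilityMeasure μ] [IsProbabilityMeasure ν]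
    (h : ∀ θ : ℝ, 0 < θ → realLaplace μ θ = realLaplace ν θ) : μ = ν := by
  have h1 : (1 : ℂ) ∈ rightHalfPlane := by simp [rightHalfPlane]
  let e : BoundedContinuousFunction ℝ≥0∞ ℝ := BoundedContinuousFunction.mkOfCompact
    ⟨fun y => (laplaceKernel 1 y).re,
      Complex.continuous_re.comp (continuous_laplaceKernel_right h1)⟩
  have he : ∀ y, e y = if y = ∞ then 0 else Real.exp (-y.toReal) := fun y => by
    change (laplaceKernel 1 y).re = _
    split_ifs with hy
    · simp [hy]
    · rw [laplaceKernel_of_ne_top _ hy, neg_one_mul, ← Complex.ofReal_neg, Complex.exp_ofReal_re]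
  have hmom : ∀ (μ : Measure ℝ≥0∞) (n : ℕ), ∫ y, (e ^ (n + 1)) y ∂μ = realLaplace μ (n + 1) := by
    intro μ n
    rw [realLaplace, ← integral_indicator measurableSet_Iio]
    refine integral_congr_ae (ae_of_all _ fun y => ?_)
    simp only [BoundedContinuousFunction.coe_pow, Pi.pow_apply, he]
    by_cases hy : y = ∞
    · simp [hy]
    · simp only [hy, if_false, indicator, mem_Iio, lt_top_iff_ne_top, ne_eq, not_false_eq_true,
        if_true, ← Real.exp_nat_mul]
      congr 1; push_cast; ring
  let A : StarSubalgebra ℝ (BoundedContinuousFunction ℝ≥0∞ ℝ) :=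
    { Algebra.adjoin ℝ {e} with
      star_mem' := fun {a} ha => by
        have : star a = a := by ext; simp
        rwa [this] }
  refine ext_of_forall_mem_subalgebra_integral_eq_of_polish (𝕜 := ℝ) (A := A) ?_ ?_
  · intro x y hxy
    refine ⟨e, ⟨_, ⟨e, Algebra.self_mem_adjoin_singleton ℝ e, rfl⟩, rfl⟩, ?_⟩
    rw [he, he]
    split_ifs with h1 h2 h2
    · exact absurd (h1.trans h2.symm) hxy
    · exact (Real.exp_pos _).ne
    · exact (Real.exp_pos _).ne'
    · intro h
      exact hxy ((ENNReal.toReal_eq_toReal_iff' h1 h2).1 (neg_injective (Real.exp_injective h)))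
  · intro g hg
    have hg : g ∈ Algebra.adjoin ℝ {e} := hg
    rw [Algebra.adjoin_singleton_eq_range_aeval] at hg
    obtain ⟨p, rfl⟩ := hg
    induction p using Polynomial.induction_on' with
    | add p q hp hq =>
      simp only [AlgHom.toRingHom_eq_coe, RingHom.coe_coe, map_add,
        BoundedContinuousFunction.coe_add, Pi.add_apply] at hp hq ⊢
      rw [integral_add (BoundedContinuousFunction.integrable μ _)
        (BoundedContinuousFunction.integrable μ _),
        integral_add (BoundedContinuousFunction.integrable ν _)
        (BoundedContinuousFunction.integrable ν _), hp (Polynomial.aeval_mem_adjoin_singleton ℝ e),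
        hq (Polynomial.aeval_mem_adjoin_singleton ℝ e)]
    | monomial n a =>
      -- The constant term is matched by total mass `1`; every higher power of `e` integrates to the
      -- transform at a positive integer.
      rcases n with _ | n
      · simp
      · simp only [AlgHom.toRingHom_eq_coe, RingHom.coe_coe, Polynomial.aeval_monomial,
          Algebra.algebraMap_eq_smul_one, smul_mul_assoc, one_mul,
          BoundedContinuousFunction.coe_smul, integral_const_mul, smul_eq_mul]
        rw [hmom, hmom, h _ (by positivity)]

/-! ### Laplace transforms and weak convergence -/

/-- The Laplace transform is jointly continuous in the measure and in the variable. -/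
lemma continuous_laplace : Continuous fun q : ProbabilityMeasure ℝ≥0∞ × rightHalfPlane =>
    laplace q.1 q.2 := by
  let E : rightHalfPlane → C(ℝ≥0∞, ℂ) := fun ζ => ⟨_, continuous_laplaceKernel_right ζ.2⟩
  have hE : Continuous E :=
    ContinuousMap.continuous_of_continuous_uncurry _ continuous_laplaceKernel
  rw [continuous_iff_continuousAt]
  rintro ⟨μ, ζ⟩
  have h1 : Tendsto (fun q : ProbabilityMeasure ℝ≥0∞ × rightHalfPlane => laplace q.1 ζ)
      (𝓝 (μ, ζ)) (𝓝 (laplace μ ζ)) :=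
    (ProbabilityMeasure.tendsto_iff_forall_integral_rclike_tendsto ℂ).1
      (continuous_fst.tendsto (μ, ζ)) (BoundedContinuousFunction.mkOfCompact (E ζ))
  -- Compactness of `[0, ∞]` makes the kernel continuous in `ζ` for the sup norm, so the change of
  -- variable costs an error uniform over all probability measures.
  have h2 : Tendsto (fun q : ProbabilityMeasure ℝ≥0∞ × rightHalfPlane =>
      laplace q.1 q.2 - laplace q.1 ζ) (𝓝 (μ, ζ)) (𝓝 0) := by
    have h3 : Tendsto (fun q : ProbabilityMeasure ℝ≥0∞ × rightHalfPlane => ‖E q.2 - E ζ‖)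
        (𝓝 (μ, ζ)) (𝓝 0) := by
      have : Continuous fun q : ProbabilityMeasure ℝ≥0∞ × rightHalfPlane => ‖E q.2 - E ζ‖ := by
        fun_prop
      simpa using this.tendsto (μ, ζ)
    refine squeeze_zero_norm (fun q => ?_) h3
    rw [laplace, laplace, ← integral_sub (integrable_laplaceKernel _ q.2.2)
      (integrable_laplaceKernel _ ζ.2)]
    refine (norm_integral_le_of_norm_le_const (C := ‖E q.2 - E ζ‖)
      (ae_of_all _ fun y => ?_)).trans (by simp)
    exact (E q.2 - E ζ).norm_coe_le_norm y
  simpa [ContinuousAt] using h2.add h1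

/-- A family of probability measures on `[0, ∞]` is weakly continuous as soon as its Laplace
transforms are. -/
lemma continuous_of_continuous_realLaplace {X : Type*} [TopologicalSpace X]
    {μ : X → ProbabilityMeasure ℝ≥0∞}
    (h : ∀ θ : ℝ, 0 < θ → Continuous fun x => realLaplace (μ x) θ) : Continuous μ := by
  let Φ : ProbabilityMeasure ℝ≥0∞ → (Ioi (0 : ℝ) → ℂ) := fun ν θ => laplace ν (θ : ℝ)
  have hΦ : Continuous Φ := continuous_pi fun θ =>
    continuous_laplace.comp (Continuous.prodMk_left
      (⟨((θ : ℝ) : ℂ), ofReal_mem_rightHalfPlane θ.2⟩ : rightHalfPlane))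
  have hinj : Function.Injective Φ := fun ν ν' hν => by
    have := ν.2
    have := ν'.2
    refine Subtype.ext (ext_of_realLaplace_eq (μ := ν.1) (ν := ν'.1) fun θ hθ => ?_)
    refine Complex.ofReal_injective ?_
    rw [← laplace_ofReal, ← laplace_ofReal]
    exact congrFun hν ⟨θ, hθ⟩
  -- A continuous injection of a compact space into a Hausdorff space is an embedding, so weak
  -- continuity can be tested on transforms.
  rw [(hΦ.isClosedEmbedding hinj).isInducing.continuous_iff]
  refine continuous_pi fun θ => ?_
  simp only [Function.comp_def, Φ, laplace_ofReal]
  exact Complex.continuous_ofReal.comp (h θ θ.2)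

lemma laplace_dirac (x : ℝ≥0∞) (ζ : ℂ) : laplace (Measure.dirac x) ζ = laplaceKernel ζ x :=
  integral_dirac _ _

lemma laplace_conv (μ ν : Measure ℝ≥0∞) [IsFiniteMeasure μ] [IsFiniteMeasure ν] (ζ : ℂ) :
    laplace (μ.conv ν) ζ = laplace μ ζ * laplace ν ζ := by
  rw [laplace, Measure.conv, integral_map (by fun_prop)
    (measurable_laplaceKernel ζ).aestronglyMeasurable]
  simp only [laplaceKernel_add]
  rw [integral_prod_mul]
  rfl

lemma laplace_comp (κ η : Kernel ℝ≥0∞ ℝ≥0∞) [IsMarkovKernel κ] [IsMarkovKernel η] (x : ℝ≥0∞)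
    {ζ : ℂ} (hζ : ζ ∈ rightHalfPlane) :
    laplace ((η ∘ₖ κ) x) ζ = ∫ y, laplace (η y) ζ ∂(κ x) :=
  Kernel.integral_comp (integrable_laplaceKernel _ hζ)

/-! ### Completely monotone functions and Bernstein functions -/

/-- Leibniz's rule applied to `(exp (-x φ))' = -x φ' exp (-x φ)`. The recursion drives both
directions of the correspondence between Bernstein and completely monotone functions; the factor `x`
in front can be divided out before letting `x → 0`. -/
lemma iteratedDeriv_succ_exp_neg_mul {φ : ℝ → ℝ}
    (hφ : ContDiffOn ℝ ((⊤ : ℕ∞) : WithTop ℕ∞) φ (Ioi 0)) (x : ℝ) (n : ℕ) {θ : ℝ} (hθ : 0 < θ) :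
    iteratedDeriv (n + 1) (fun t => Real.exp (-x * φ t)) θ =
      -x * ∑ i ∈ Finset.range (n + 1), n.choose i * iteratedDeriv (i + 1) φ θ *
        iteratedDeriv (n - i) (fun t => Real.exp (-x * φ t)) θ := by
  have hs : ∀ t : ℝ, 0 < t → ContDiffAt ℝ ((⊤ : ℕ∞) : WithTop ℕ∞) φ t := fun t ht =>
    hφ.contDiffAt (isOpen_Ioi.mem_nhds ht)
  have hd : ContDiffAt ℝ ((⊤ : ℕ∞) : WithTop ℕ∞) (deriv φ) θ :=
    (hφ.deriv_of_isOpen isOpen_Ioi le_rfl).contDiffAt (isOpen_Ioi.mem_nhds hθ)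
  have he : deriv (fun t => Real.exp (-x * φ t)) =ᶠ[𝓝 θ]
      fun t => -x * (deriv φ * fun t => Real.exp (-x * φ t)) t := by
    filter_upwards [isOpen_Ioi.mem_nhds hθ] with t ht
    have h1 : HasDerivAt φ (deriv φ t) t :=
      ((hs t ht).differentiableAt (by simp)).hasDerivAt
    rw [((h1.const_mul (-x)).exp).deriv]
    simp only [Pi.mul_apply]
    ring
  rw [iteratedDeriv_succ', he.iteratedDeriv_eq, iteratedDeriv_const_mul_field]
  congr 1
  rw [iteratedDeriv_mul]
  · simp only [iteratedDeriv_succ']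
  · exact hd.of_le (by exact_mod_cast le_top)
  · have : ContDiffAt ℝ ((⊤ : ℕ∞) : WithTop ℕ∞) (fun t => Real.exp (-x * φ t)) θ :=
      (contDiffAt_const.mul (hs θ hθ)).exp
    exact this.of_le (by exact_mod_cast le_top)

/-- The exponential of minus a Bernstein function is completely monotone. -/
lemma IsBernstein.iteratedDeriv_exp_sign {φ : ℝ → ℝ} (hφ : IsBernstein φ) {x : ℝ} (hx : 0 ≤ x)
    (n : ℕ) {θ : ℝ} (hθ : 0 < θ) :
    0 ≤ (-1) ^ n * iteratedDeriv n (fun t => Real.exp (-x * φ t)) θ := by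
  induction n using Nat.strong_induction_on with
  | _ n ih =>
    rcases n with _ | n
    · simpa using (Real.exp_pos _).le
    · rw [iteratedDeriv_succ_exp_neg_mul hφ.smooth x n hθ, pow_succ, mul_assoc,
        show ∀ S : ℝ, (-1 : ℝ) * (-x * S) = x * S by intro S; ring, mul_left_comm, Finset.mul_sum]
      refine mul_nonneg hx (Finset.sum_nonneg fun i hi => ?_)
      have hi : i ≤ n := Nat.lt_succ_iff.1 (Finset.mem_range.1 hi)
      have h1 := hφ.deriv_sign (i + 1) (by omega) θ hθ
      have h2 := ih (n - i) (by omega)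
      rw [Nat.add_sub_cancel] at h1
      have h3 := mul_nonneg (Nat.cast_nonneg (α := ℝ) (n.choose i)) (mul_nonneg h1 h2)
      convert h3 using 1
      rw [show (-1 : ℝ) ^ n = (-1) ^ i * (-1) ^ (n - i) by rw [← pow_add]; congr 1; omega]
      ring

/-- If `exp (-x φ)` is completely monotone for all `x > 0`, then `φ` is a Bernstein function. -/
lemma IsBernstein.of_iteratedDeriv_exp_sign {φ : ℝ → ℝ}
    (hφ : ContDiffOn ℝ ((⊤ : ℕ∞) : WithTop ℕ∞) φ (Ioi 0)) (h0 : ∀ θ : ℝ, 0 < θ → 0 ≤ φ θ)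
    (h : ∀ x : ℝ, 0 < x → ∀ (n : ℕ) (θ : ℝ), 0 < θ →
      0 ≤ (-1) ^ n * iteratedDeriv n (fun t => Real.exp (-x * φ t)) θ) : IsBernstein φ := by
  refine ⟨hφ, h0, fun n hn θ hθ => ?_⟩
  obtain ⟨n, rfl⟩ : ∃ m, n = m + 1 := ⟨n - 1, by omega⟩
  rw [Nat.add_sub_cancel]
  have hzero : ∀ x : ℝ, iteratedDeriv 0 (fun t => Real.exp (-x * φ t)) θ = Real.exp (-x * φ θ) :=
    fun x => by rw [iteratedDeriv_zero]
  -- Continuity in the parameter `x`, by strong induction through the recursion, permits the limit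
  -- `x → 0+`.
  have hcont : ∀ m, Continuous fun x : ℝ => iteratedDeriv m (fun t => Real.exp (-x * φ t)) θ := by
    intro m
    induction m using Nat.strong_induction_on with
    | _ m ih =>
      rcases m with _ | m
      · simp only [hzero]
        fun_prop
      · simp only [iteratedDeriv_succ_exp_neg_mul hφ _ m hθ]
        refine continuous_id.neg.mul (continuous_finsetSum _ fun i _ => ?_)
        exact continuous_const.mul (ih (m - i) (by omega))
  have hat : ∀ m, 0 < m → iteratedDeriv m (fun t => Real.exp (-(0 : ℝ) * φ t)) θ = 0 := by
    rintro (_ | m) hm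
    · omega
    · rw [iteratedDeriv_succ_exp_neg_mul hφ _ m hθ]; simp
  let S : ℝ → ℝ := fun x => ∑ i ∈ Finset.range (n + 1), n.choose i * iteratedDeriv (i + 1) φ θ *
        iteratedDeriv (n - i) (fun t => Real.exp (-x * φ t)) θ
  have hS : Continuous S :=
    continuous_finsetSum _ fun i _ => continuous_const.mul (hcont (n - i))
  -- At `x = 0` the exponential is constant, so only the summand `i = n`, with no derivative on the
  -- exponential, survives.
  have hS0 : S 0 = iteratedDeriv (n + 1) φ θ := by
    simp only [S]
    rw [Finset.sum_eq_single n]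
    · simp
    · intro i hi hin
      rw [hat _ (by have := Finset.mem_range.1 hi; omega), mul_zero]
    · simp
  have hpos : ∀ x : ℝ, 0 < x → 0 ≤ (-1) ^ n * S x := by
    intro x hx
    have := h x hx (n + 1) θ hθ
    rw [iteratedDeriv_succ_exp_neg_mul hφ x n hθ] at this
    have h2 : 0 ≤ x * ((-1) ^ n * S x) := by
      convert this using 1
      simp only [S]
      ring
    exact nonneg_of_mul_nonneg_right h2 hx
  rw [← hS0]
  have hlim : Tendsto (fun x => (-1) ^ n * S x) (𝓝[>] 0) (𝓝 ((-1) ^ n * S 0)) :=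
    ((hS.tendsto 0).const_mul _).mono_left nhdsWithin_le_nhds
  exact ge_of_tendsto hlim (eventually_nhdsWithin_of_forall hpos)

/-! ### Real and complex derivatives on the half-line -/

/-- The restriction to the real line of a holomorphic function that is real on `(0, ∞)`. -/
lemma deriv_eq_of_eqOn_ofReal {F : ℂ → ℂ} (hF : DifferentiableOn ℂ F rightHalfPlane) {f : ℝ → ℝ}
    (hf : ∀ θ : ℝ, 0 < θ → F θ = f θ) {θ : ℝ} (hθ : 0 < θ) :
    deriv F θ = deriv f θ := by
  have h1 : HasDerivAt F (deriv F θ) θ := (hF.differentiableAt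
    (isOpen_rightHalfPlane.mem_nhds (ofReal_mem_rightHalfPlane hθ))).hasDerivAt
  have he : (fun t : ℝ => F t) =ᶠ[𝓝 θ] fun t => (f t : ℂ) := by
    filter_upwards [isOpen_Ioi.mem_nhds hθ] with t ht using hf t ht
  have h2 : HasDerivAt (fun t : ℝ => (f t : ℂ)) (deriv F θ) θ :=
    h1.comp_ofReal.congr_of_eventuallyEq he.symm
  have h3 : HasDerivAt f (deriv F θ).re θ := by
    refine h1.real_of_complex.congr_of_eventuallyEq ?_
    filter_upwards [he] with t ht
    simp [ht]
  rw [h3.deriv]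
  exact h2.unique h3.ofReal_comp

/-- Transfers the sign conditions on real derivatives to the Taylor coefficients of the holomorphic
extension. -/
lemma iteratedDeriv_eq_of_eqOn_ofReal (n : ℕ) {F : ℂ → ℂ}
    (hF : DifferentiableOn ℂ F rightHalfPlane) {f : ℝ → ℝ}
    (hf : ∀ θ : ℝ, 0 < θ → F θ = f θ) {θ : ℝ} (hθ : 0 < θ) :
    iteratedDeriv n F θ = iteratedDeriv n f θ := by
  induction n generalizing F f with
  | zero => simpa using hf θ hθ
  | succ n ih =>
    rw [iteratedDeriv_succ', iteratedDeriv_succ']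
    exact ih (hF.deriv isOpen_rightHalfPlane) fun t ht => deriv_eq_of_eqOn_ofReal hF hf ht

lemma contDiffOn_of_eqOn_ofReal {F : ℂ → ℂ}
    (hF : DifferentiableOn ℂ F rightHalfPlane) {f : ℝ → ℝ}
    (hf : ∀ θ : ℝ, 0 < θ → F θ = f θ) :
    ContDiffOn ℝ ((⊤ : ℕ∞) : WithTop ℕ∞) f (Ioi 0) := by
  intro θ hθ
  have h1 : ContDiffAt ℂ ((⊤ : ℕ∞) : WithTop ℕ∞) F θ :=
    (hF.contDiffOn isOpen_rightHalfPlane).contDiffAt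
      (isOpen_rightHalfPlane.mem_nhds (ofReal_mem_rightHalfPlane hθ))
  refine (h1.real_of_complex.congr_of_eventuallyEq ?_).contDiffWithinAt
  filter_upwards [isOpen_Ioi.mem_nhds hθ] with t ht
  simp [hf t ht]

/-! ### Bernstein's theorem -/

lemma hasSum_laplace_sum_dirac {c : ℕ → ℝ} (hc0 : ∀ n, 0 ≤ c n) (hc1 : HasSum c 1) (d : ℕ → ℝ≥0∞)
    {ζ : ℂ} (hζ : ζ ∈ rightHalfPlane) :
    HasSum (fun n => (c n : ℂ) * laplaceKernel ζ (d n))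
      (laplace (Measure.sum fun n => ENNReal.ofReal (c n) • .dirac (d n)) ζ) := by
  have : IsProbabilityMeasure (Measure.sum fun n => ENNReal.ofReal (c n) • .dirac (d n)) :=
    HasSum.isProbabilityMeasure_sum_dirac hc0 hc1
  have h := hasSum_integral_measure (integrable_laplaceKernel
    (Measure.sum fun n => ENNReal.ofReal (c n) • .dirac (d n)) hζ)
  simp only [integral_smul_measure, integral_dirac, ENNReal.toReal_ofReal (hc0 _),
    Complex.real_smul] at h
  exact h

/-- A power series with nonnegative coefficients that is bounded by `1` on `[0, 1)` is the
Laplace transform of a probability measure on `[0, ∞]`, after a change of variables. -/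
lemma exists_probabilityMeasure_of_hasSum {p : ℕ → ℝ} (hp : ∀ k, 0 ≤ p k) {g : ℝ → ℝ}
    (hg : ∀ s : ℝ, 0 ≤ s → s < 1 → HasSum (fun k => p k * s ^ k) (g s))
    (hg1 : ∀ s : ℝ, 0 ≤ s → s < 1 → g s ≤ 1) {a : ℝ} (ha : 0 < a) :
    ∃ μ : ProbabilityMeasure ℝ≥0∞, ∀ θ : ℝ, 0 < θ →
      laplace μ θ = g (Real.exp (-(θ / a))) := by
  -- Let `s → 1-` in the partial sums, which are bounded by `g s ≤ 1`.
  have hpart : ∀ N, ∑ k ∈ Finset.range N, p k ≤ 1 := by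
    intro N
    have hc : Continuous fun s : ℝ => ∑ k ∈ Finset.range N, p k * s ^ k := by fun_prop
    have hlim : Tendsto (fun s : ℝ => ∑ k ∈ Finset.range N, p k * s ^ k) (𝓝[<] 1)
        (𝓝 (∑ k ∈ Finset.range N, p k)) := by
      simpa using (hc.tendsto 1).mono_left (nhdsWithin_le_nhds (s := Iio 1))
    refine le_of_tendsto hlim ?_
    filter_upwards [Ioo_mem_nhdsLT (zero_lt_one' ℝ)] with s hs
    exact (sum_le_hasSum _ (fun k _ => mul_nonneg (hp k) (pow_nonneg hs.1.le k))
      (hg s hs.1.le hs.2)).trans (hg1 s hs.1.le hs.2)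
  have hsum : Summable p := summable_of_sum_range_le hp hpart
  have htot : ∑' k, p k ≤ 1 := hsum.tsum_le_of_sum_range_le hpart
  -- The measure puts mass `p k` at `k / a` and the missing mass at `∞`, where the kernel vanishes.
  -- Index `0` is reserved for `∞`, hence the shift by one.
  obtain ⟨c, hcz, hcs⟩ : ∃ c : ℕ → ℝ, c 0 = 1 - ∑' k, p k ∧ ∀ k, c (k + 1) = p k :=
    ⟨fun n => if n = 0 then 1 - ∑' k, p k else p (n - 1), by simp, by simp⟩
  obtain ⟨d, hdz, hds⟩ : ∃ d : ℕ → ℝ≥0∞, d 0 = ∞ ∧ ∀ k : ℕ, d (k + 1) = ENNReal.ofReal (k / a) :=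
    ⟨fun n => if n = 0 then ∞ else ENNReal.ofReal ((n - 1 : ℕ) / a), by simp, by simp⟩
  have hc0 : ∀ n, 0 ≤ c n := by
    rintro (_ | n)
    · exact hcz ▸ sub_nonneg.2 htot
    · exact hcs n ▸ hp n
  have hc1 : HasSum c 1 := by
    have := (hasSum_nat_add_iff (f := c) 1).1 (by simpa only [hcs] using hsum.hasSum)
    simpa [hcz] using this
  refine ⟨⟨_, HasSum.isProbabilityMeasure_sum_dirac (d := d) hc0 hc1⟩, fun θ hθ => ?_⟩
  refine (hasSum_laplace_sum_dirac hc0 hc1 d (ofReal_mem_rightHalfPlane hθ)).unique ?_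
  have h2 := Complex.hasSum_ofReal.2 (hg (Real.exp (-(θ / a))) (Real.exp_pos _).le
    (Real.exp_lt_one_iff.2 (by simpa using div_pos hθ ha)))
  have he : (fun k => ((p k * Real.exp (-(θ / a)) ^ k : ℝ) : ℂ)) =
      fun k => (c (k + 1) : ℂ) * laplaceKernel θ (d (k + 1)) := by
    funext k
    rw [hcs, hds, laplaceKernel_of_ne_top _ ENNReal.ofReal_ne_top, ENNReal.toReal_ofReal (by positivity),
      ← Real.exp_nat_mul]
    push_cast
    congr 2
    ring
  rw [he] at h2
  have h3 := (hasSum_nat_add_iff (f := fun i => (c i : ℂ) * laplaceKernel θ (d i)) 1).1 h2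
  simpa [hdz] using h3

/-- The difference quotient at `0` of `u ↦ 1 - exp (-θ u)`, taken along `u = 1 / (m + 1)`. -/
lemma tendsto_mul_one_sub_exp (θ : ℝ) :
    Tendsto (fun m : ℕ => ((m : ℝ) + 1) * (1 - Real.exp (-(θ / ((m : ℝ) + 1))))) atTop (𝓝 θ) := by
  have h1 : HasDerivAt (fun u : ℝ => 1 - Real.exp (-(θ * u))) θ 0 := by
    have := ((((hasDerivAt_id (0 : ℝ)).const_mul θ).neg).exp).const_sub 1
    simpa using this
  have h2 : Tendsto (fun m : ℕ => (1 : ℝ) / ((m : ℝ) + 1)) atTop (𝓝[≠] 0) :=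
    tendsto_nhdsWithin_iff.2 ⟨tendsto_one_div_add_atTop_nhds_zero_nat,
      Eventually.of_forall fun m => (by positivity : (1 : ℝ) / ((m : ℝ) + 1) ≠ 0)⟩
  refine ((hasDerivAt_iff_tendsto_slope_zero.1 h1).comp h2).congr fun m => ?_
  simp [div_eq_mul_inv]

/-- **Bernstein's theorem** for completely monotone functions that are bounded by `1` and have a
holomorphic extension to the right half-plane. -/
theorem exists_realLaplace_eq {F : ℂ → ℂ} (hF : DifferentiableOn ℂ F rightHalfPlane) {f : ℝ → ℝ}
    (hf : ∀ θ : ℝ, 0 < θ → F θ = f θ)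
    (hcm : ∀ (n : ℕ) (θ : ℝ), 0 < θ → 0 ≤ (-1) ^ n * iteratedDeriv n f θ)
    (hf1 : ∀ θ : ℝ, 0 < θ → f θ ≤ 1) :
    ∃ μ : ProbabilityMeasure ℝ≥0∞, ∀ θ : ℝ, 0 < θ → realLaplace μ θ = f θ := by
  have key : ∀ m : ℕ, ∃ μ : ProbabilityMeasure ℝ≥0∞, ∀ θ : ℝ, 0 < θ →
      laplace μ θ = f (((m : ℝ) + 1) * (1 - Real.exp (-(θ / ((m : ℝ) + 1))))) := by
    intro m
    set a : ℝ := (m : ℝ) + 1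
    have ha : 0 < a := by positivity
    -- Taylor expansion about `a` at the point `a (1 - s)`: the signs of `(-a) ^ k` and of the
    -- `k`-th derivative cancel, so the coefficients of `s ^ k` are nonnegative. The disc of radius
    -- `a` about `a` lies in the half-plane, so the series converges for all `0 ≤ s < 1`.
    refine exists_probabilityMeasure_of_hasSum
      (p := fun k => (k.factorial : ℝ)⁻¹ * ((-a) ^ k * iteratedDeriv k f a))
      (g := fun s => f (a * (1 - s))) (fun k => ?_) (fun s hs0 hs1 => ?_)
      (fun s hs0 hs1 => hf1 _ (mul_pos ha (by linarith))) ha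
    · rw [neg_pow, mul_comm _ (a ^ k), mul_assoc]
      have := hcm k a ha
      positivity
    · have hball : Metric.ball (a : ℂ) a ⊆ rightHalfPlane := by
        intro z hz
        have h1 := (Complex.abs_re_le_norm (z - a)).trans_lt (mem_ball_iff_norm.1 hz)
        simp only [Complex.sub_re, Complex.ofReal_re] at h1
        have := (abs_lt.1 h1).1
        change 0 < z.re
        linarith
      have hz : ((a * (1 - s) : ℝ) : ℂ) ∈ Metric.ball (a : ℂ) a := by
        rw [mem_ball_iff_norm, ← Complex.ofReal_sub, Complex.norm_real, Real.norm_eq_abs, abs_lt]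
        constructor <;> nlinarith
      have h := Complex.hasSum_taylorSeries_on_ball (hF.mono hball) hz
      rw [hf _ (mul_pos ha (by linarith))] at h
      rw [← Complex.hasSum_ofReal]
      have he : (fun k => (((k.factorial : ℝ)⁻¹ * ((-a) ^ k * iteratedDeriv k f a) * s ^ k : ℝ) : ℂ))
          = fun k => (k.factorial : ℂ)⁻¹ • (((a * (1 - s) : ℝ) : ℂ) - a) ^ k •
            iteratedDeriv k F a := by
        funext k
        rw [iteratedDeriv_eq_of_eqOn_ofReal k hF hf ha, smul_eq_mul, smul_eq_mul,
          show ((a * (1 - s) : ℝ) : ℂ) - a = -a * s by push_cast; ring, mul_pow]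
        push_cast
        ring
      rw [he]
      exact h
  choose μ hμ using key
  -- Compactness gives a limit along an ultrafilter; its transform is identified because `a (1 - exp
  -- (-θ / a)) → θ` as `a → ∞`.
  let U : Ultrafilter (ProbabilityMeasure ℝ≥0∞) := (hyperfilter ℕ).map μ
  have hU : Tendsto μ (hyperfilter ℕ) (𝓝 U.lim) := U.le_nhds_lim
  refine ⟨U.lim, fun θ hθ => ?_⟩
  have h1 : Tendsto (fun m => laplace (μ m) θ) (hyperfilter ℕ) (𝓝 (laplace U.lim θ)) :=
    ((continuous_laplace.comp (Continuous.prodMk_left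
      (⟨θ, ofReal_mem_rightHalfPlane hθ⟩ : rightHalfPlane))).tendsto U.lim).comp hU
  have h2 : Tendsto (fun m => laplace (μ m) θ) atTop (𝓝 (f θ)) := by
    simp only [hμ _ θ hθ]
    have hc : ContinuousAt f θ :=
      ((contDiffOn_of_eqOn_ofReal hF hf).contDiffAt (isOpen_Ioi.mem_nhds hθ)).continuousAt
    exact (Complex.continuous_ofReal.tendsto _).comp (hc.tendsto.comp (tendsto_mul_one_sub_exp θ))
  have h3 := tendsto_nhds_unique h1 (h2.mono_left Nat.hyperfilter_le_atTop)
  rw [laplace_ofReal] at h3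
  exact Complex.ofReal_injective h3

/-! ### From evolution families to branching processes -/

lemma norm_laplace_le_one (μ : Measure ℝ≥0∞) [IsProbabilityMeasure μ] {ζ : ℂ}
    (hζ : ζ ∈ rightHalfPlane) : ‖laplace μ ζ‖ ≤ 1 :=
  (norm_integral_le_of_norm_le_const (ae_of_all _ (norm_laplaceKernel_le_one hζ))).trans (by simp)

lemma realLaplace_nonneg (μ : Measure ℝ≥0∞) (θ : ℝ) : 0 ≤ realLaplace μ θ :=
  integral_nonneg fun _ => (Real.exp_pos _).le

lemma ext_of_laplace_eq {μ ν : Measure ℝ≥0∞} [IsProbabilityMeasure μ] [IsProbabilityMeasure ν]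
    (h : ∀ θ : ℝ, 0 < θ → laplace μ θ = laplace ν θ) : μ = ν :=
  ext_of_realLaplace_eq fun θ hθ => Complex.ofReal_injective (by
    rw [← laplace_ofReal, ← laplace_ofReal, h θ hθ])

@[simp] lemma laplaceKernel_zero_right (ζ : ℂ) : laplaceKernel ζ 0 = 1 := by
  simpa using laplaceKernel_coe ζ 0

/-- A weakly continuous family of probability measures is measurable. -/
lemma measurable_of_continuous_probabilityMeasure {X Ω : Type*} [TopologicalSpace X]
    [MeasurableSpace X] [OpensMeasurableSpace X] [TopologicalSpace Ω]
    [MeasurableSpace Ω] [BorelSpace Ω] [HasOuterApproxClosed Ω]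
    {μ : X → ProbabilityMeasure Ω} (hμ : Continuous μ) : Measurable fun x => (μ x : Measure Ω) := by
  refine Measurable.measure_of_isPiSystem_of_isProbabilityMeasure
    (BorelSpace.measurable_eq (α := Ω)) isPiSystem_isOpen fun s hs => ?_
  -- By the portmanteau theorem the mass of an open set is lower semicontinuous under weak
  -- convergence.
  refine LowerSemicontinuous.measurable fun x => ?_
  refine lowerSemicontinuousAt_iff_le_liminf.2 ?_
  exact ProbabilityMeasure.le_liminf_measure_open_of_tendsto (hμ.tendsto x) hs

/-- The traps at `0` and `∞` extend the exponent formula to every starting point, so that it can be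
integrated over all of `[0, ∞]` in Chapman–Kolmogorov. -/
lemma IsLaplaceExponent.laplace_eq {κ : Kernel ℝ≥0∞ ℝ≥0∞} {φ : ℝ → ℝ} (hφ : IsLaplaceExponent κ φ)
    (h0 : κ 0 = Measure.dirac 0) (htop : κ ∞ = Measure.dirac ∞) {θ : ℝ} (hθ : 0 < θ) (y : ℝ≥0∞) :
    _root_.laplace (κ y) θ = laplaceKernel (φ θ) y := by
  by_cases hy : y = ∞
  · rw [hy, htop, laplace_dirac, laplaceKernel_top, laplaceKernel_top]
  by_cases hy0 : y = 0
  · rw [hy0, h0, laplace_dirac, laplaceKernel_zero_right, laplaceKernel_zero_right]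
  have h := hφ.laplace y.toReal θ (ENNReal.toReal_pos hy0 hy) hθ
  rw [ENNReal.ofReal_toReal hy] at h
  rw [laplace_ofReal, laplaceKernel_of_ne_top _ hy, realLaplace, h]
  push_cast
  congr 1
  ring

lemma IsBranchingKernelFamily.comp_eq {k : TimePair → Kernel ℝ≥0∞ ℝ≥0∞}
    (hk : IsBranchingKernelFamily k) {s t u : ℝ≥0} (hst : s ≤ t) (htu : t ≤ u) (x : ℝ≥0∞) :
    (k (TimePair.mk' t u htu) ∘ₖ k (TimePair.mk' s t hst)) x =
      k (TimePair.mk' s u (hst.trans htu)) x := by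
  ext B hB
  rw [Kernel.comp_apply' _ _ _ hB, hk.chapman_kolmogorov s t u hst htu x B hB]

/-- The kernel on `[0, ∞]` that extends a weakly continuous family `(μ x)`, `0 ≤ x < ∞`, and has
`∞` as a trap. -/
noncomputable def trapKernel (μ : ℝ≥0 → ProbabilityMeasure ℝ≥0∞) (hμ : Continuous μ) :
    Kernel ℝ≥0∞ ℝ≥0∞ where
  toFun x := if x = ∞ then Measure.dirac ∞ else μ x.toNNReal
  measurable' := Measurable.ite (measurableSet_singleton ∞) measurable_const
    ((measurable_of_continuous_probabilityMeasure hμ).comp ENNReal.measurable_toNNReal)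

lemma trapKernel_top (μ : ℝ≥0 → ProbabilityMeasure ℝ≥0∞) (hμ : Continuous μ) :
    trapKernel μ hμ ∞ = Measure.dirac ∞ := by simp [trapKernel]

lemma trapKernel_coe (μ : ℝ≥0 → ProbabilityMeasure ℝ≥0∞) (hμ : Continuous μ) (x : ℝ≥0) :
    trapKernel μ hμ x = μ x := by simp [trapKernel]

instance (μ : ℝ≥0 → ProbabilityMeasure ℝ≥0∞) (hμ : Continuous μ) :
    IsMarkovKernel (trapKernel μ hμ) := by
  refine ⟨fun x => ?_⟩
  induction x with
  | top => rw [trapKernel_top]; infer_instance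
  | coe x => rw [trapKernel_coe]; infer_instance

lemma IsHolExtension.pos {f : Hol rightHalfPlane rightHalfPlane} {φ : ℝ → ℝ}
    (h : IsHolExtension f φ) {θ : ℝ} (hθ : 0 < θ) : 0 < φ θ := by
  have h1 : 0 < ((f.1 (posToHalfPlane θ hθ) : rightHalfPlane) : ℂ).re :=
    (f.1 (posToHalfPlane θ hθ)).2
  rwa [h θ hθ, Complex.ofReal_re] at h1

lemma IsHolExtension.apply_eq {f : Hol rightHalfPlane rightHalfPlane} {φ : ℝ → ℝ}
    (h : IsHolExtension f φ) {θ : ℝ} (hθ : 0 < θ) :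
    f.1 (posToHalfPlane θ hθ) = posToHalfPlane (φ θ) (h.pos hθ) :=
  Subtype.ext (h θ hθ)

lemma IsHolExtension.eq_of_eq {f : Hol rightHalfPlane rightHalfPlane} {φ ψ : ℝ → ℝ}
    (hφ : IsHolExtension f φ) (hψ : IsHolExtension f ψ) {θ : ℝ} (hθ : 0 < θ) : φ θ = ψ θ :=
  Complex.ofReal_injective ((hφ θ hθ).symm.trans (hψ θ hθ))

lemma IsHolExtension.exists_probabilityMeasure {f : Hol rightHalfPlane rightHalfPlane} {φ : ℝ → ℝ}
    (hf : IsHolExtension f φ) (hφ : IsBernstein φ) (x : ℝ≥0) :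
    ∃ μ : ProbabilityMeasure ℝ≥0∞, ∀ θ : ℝ, 0 < θ → realLaplace μ θ = Real.exp (-x * φ θ) := by
  obtain ⟨F, hF, hFf⟩ := f.2
  refine exists_realLaplace_eq (F := fun ζ => Complex.exp (-(x : ℂ) * F ζ))
    ((hF.const_mul _).cexp) (fun θ hθ => ?_)
    (fun n θ hθ => hφ.iteratedDeriv_exp_sign x.2 n hθ) (fun θ hθ => ?_)
  · have : F θ = φ θ := (hFf (posToHalfPlane θ hθ)).trans (hf θ hθ)
    rw [this]
    push_cast
    rfl
  · rw [Real.exp_le_one_iff]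
    have := mul_nonneg x.2 (hφ.nonneg θ hθ)
    simp only [NNReal.val_eq_coe] at this
    linarith

/-- Every topological reverse evolution family of Bernstein functions consists of the Laplace
exponents of a branching process. -/
theorem IsTopologicalREF.exists_isBranchingKernelFamily
    {v : TimePair → Hol rightHalfPlane rightHalfPlane} (hv : IsTopologicalREF v)
    {φ : TimePair → ℝ → ℝ} (hφ : ∀ p, IsBernstein (φ p)) (hvφ : ∀ p, IsHolExtension (v p) (φ p)) :
    ∃ k : TimePair → Kernel ℝ≥0∞ ℝ≥0∞, IsBranchingKernelFamily k ∧
      ∀ p, IsLaplaceExponent (k p) (φ p) := by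
  choose μ hμ using fun p x => (hvφ p).exists_probabilityMeasure (hφ p) x
  have hφc : ∀ θ : ℝ, 0 < θ → Continuous fun p => φ p θ := by
    intro θ hθ
    have h1 : Continuous fun p => (((v p).1 (posToHalfPlane θ hθ) : rightHalfPlane) : ℂ).re :=
      Complex.continuous_re.comp (continuous_subtype_val.comp
        ((continuous_eval_const _).comp
          (continuous_subtype_val.comp hv.continuous)))
    simpa only [hvφ _ θ hθ, Complex.ofReal_re] using h1
  have hc : Continuous fun q : TimePair × ℝ≥0 => μ q.1 q.2 := by
    refine continuous_of_continuous_realLaplace fun θ hθ => ?_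
    simp only [hμ _ _ θ hθ]
    have := (hφc θ hθ).comp (continuous_fst (X := TimePair) (Y := ℝ≥0))
    simp only [Function.comp_def] at this
    fun_prop
  let k : TimePair → Kernel ℝ≥0∞ ℝ≥0∞ := fun p =>
    trapKernel (μ p) (hc.comp (Continuous.prodMk_right p))
  have hm : ∀ p, IsMarkovKernel (k p) := fun p => inferInstanceAs (IsMarkovKernel (trapKernel _ _))
  have hkcoe : ∀ p (x : ℝ≥0), k p x = μ p x := fun p x => trapKernel_coe _ _ x
  have hktop : ∀ p, k p ∞ = Measure.dirac ∞ := fun p => trapKernel_top _ _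
  have hL : ∀ p (y : ℝ≥0∞) (θ : ℝ), 0 < θ → laplace (k p y) θ = laplaceKernel (φ p θ) y := by
    intro p y θ hθ
    induction y with
    | top => rw [hktop, laplace_dirac, laplaceKernel_top, laplaceKernel_top]
    | coe y =>
      rw [hkcoe, laplace_ofReal, hμ p y θ hθ, laplaceKernel_coe]
      push_cast
      congr 1
      ring
  refine ⟨k, ⟨hm, fun s x => ?_, fun s t u hst htu x B hB => ?_, ?_, fun p x y => ?_,
    fun p => ?_, hktop⟩, fun p => ⟨hφ p, fun x θ hx hθ => ?_⟩⟩
  · refine ext_of_laplace_eq fun θ hθ => ?_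
    have : φ (TimePair.mk' s s le_rfl) θ = θ := Complex.ofReal_injective (by
      rw [← hvφ _ θ hθ, hv.refl]; rfl)
    rw [hL _ _ θ hθ, laplace_dirac, this]
  · rw [← Kernel.comp_apply' _ _ _ hB]
    refine congrFun (congrArg DFunLike.coe (ext_of_laplace_eq fun θ hθ => ?_)) B
    have hpos := (hvφ (TimePair.mk' t u htu)).pos hθ
    have hcomp : φ (TimePair.mk' s u (hst.trans htu)) θ =
        φ (TimePair.mk' s t hst) (φ (TimePair.mk' t u htu) θ) := Complex.ofReal_injective (by
      rw [← hvφ _ θ hθ, hv.comp s t u hst htu, (hvφ _).apply_eq hθ, hvφ _ _ hpos])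
    -- Integrating the kernel with parameter `φ_{t,u}(θ)` against `k_{s,t}(x, ·)` is again a Laplace
    -- transform, which turns Chapman–Kolmogorov into composition of exponents.
    rw [laplace_comp _ _ _ (ofReal_mem_rightHalfPlane hθ)]
    simp only [hL _ _ θ hθ]
    rw [hcomp, ← hL _ _ _ hpos]
    rfl
  · refine hc.congr fun q => Subtype.ext ?_
    exact (hkcoe q.1 q.2).symm
  · refine ext_of_laplace_eq fun θ hθ => ?_
    rw [laplace_conv, hL _ _ θ hθ, hL _ _ θ hθ, hL _ _ θ hθ, laplaceKernel_add]
  · refine ext_of_laplace_eq fun θ hθ => ?_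
    rw [hL _ _ θ hθ, laplace_dirac, laplaceKernel_zero_right, laplaceKernel_zero_right]
  · have h := hμ p x.toNNReal θ hθ
    rw [Real.coe_toNNReal x hx.le] at h
    rw [← h, ENNReal.ofReal, hkcoe]
    rfl

/-- A branching process is determined by its Laplace exponents. -/
lemma IsBranchingKernelFamily.ext {k k' : TimePair → Kernel ℝ≥0∞ ℝ≥0∞}
    (hk : IsBranchingKernelFamily k) (hk' : IsBranchingKernelFamily k') {φ φ' : TimePair → ℝ → ℝ}
    (hφ : ∀ p, IsLaplaceExponent (k p) (φ p)) (hφ' : ∀ p, IsLaplaceExponent (k' p) (φ' p))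
    (h : ∀ p θ, 0 < θ → φ p θ = φ' p θ) : k = k' := by
  funext p
  refine Kernel.ext fun y => ?_
  have := hk.markov p
  have := hk'.markov p
  refine ext_of_laplace_eq fun θ hθ => ?_
  rw [(hφ p).laplace_eq (hk.zero_absorbing p) (hk.top_absorbing p) hθ,
    (hφ' p).laplace_eq (hk'.zero_absorbing p) (hk'.top_absorbing p) hθ, h p θ hθ]

/-! ### From branching processes to evolution families -/

/-- The argument lies in `(-π/2, π/2)`, so doubling it does not leave the principal branch. -/
lemma log_sq_of_re_pos {z : ℂ} (hz : 0 < z.re) : Complex.log (z * z) = 2 * Complex.log z := by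
  have h0 : z ≠ 0 := by rintro rfl; simp at hz
  have h := abs_lt.1 (Complex.abs_arg_lt_pi_div_two_iff.2 (Or.inl hz))
  rw [Complex.log_mul h0 h0 ⟨by linarith [h.1], by linarith [h.2]⟩]
  ring

lemma re_pos_of_norm_sub_one_lt {z : ℂ} (hz : ‖z - 1‖ < 1) : 0 < z.re := by
  have := (abs_lt.1 ((Complex.abs_re_le_norm (z - 1)).trans_lt hz)).1
  simp only [Complex.sub_re, Complex.one_re] at this
  linarith

/-- A continuous family of continuous one-parameter semigroups `x ↦ ℓ w x` of complex numbers has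
the form `ℓ w x = exp (-x V w)`, where locally `V` is given by a logarithm. -/
lemma exists_semigroup_exponent {X : Type*} [TopologicalSpace X] {l : X → ℝ≥0 → ℂ}
    (hc : Continuous fun q : X × ℝ≥0 => l q.1 q.2) (h0 : ∀ w, l w 0 = 1)
    (hadd : ∀ w x y, l w (x + y) = l w x * l w y) :
    ∃ V : X → ℂ, (∀ w x, l w x = Complex.exp (-(x : ℂ) * V w)) ∧
      ∀ w₀, ∃ N : ℕ, ∀ᶠ w in 𝓝 w₀, 0 < (l w (2 ^ N)⁻¹).re ∧
        V w = -2 ^ N * Complex.log (l w (2 ^ N)⁻¹) := by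
  have hpow : Tendsto (fun m : ℕ => ((2 : ℝ≥0) ^ m)⁻¹) atTop (𝓝 0) := by
    simp only [← inv_pow]
    exact tendsto_pow_atTop_nhds_zero_of_lt_one zero_le (inv_lt_one_of_one_lt₀ one_lt_two)
  -- Joint continuity at `(w₀, 0)`, where the value is `1`, gives one `N` that serves a whole
  -- neighbourhood of `w₀`.
  have hN : ∀ w₀, ∃ N : ℕ, ∀ᶠ w in 𝓝 w₀, ∀ m ≥ N, 0 < (l w (2 ^ m)⁻¹).re := by
    intro w₀
    have h1 : ∀ᶠ q : X × ℝ≥0 in 𝓝 (w₀, 0), ‖l q.1 q.2 - 1‖ < 1 := by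
      have : Tendsto (fun q : X × ℝ≥0 => ‖l q.1 q.2 - 1‖) (𝓝 (w₀, 0)) (𝓝 0) := by
        simpa [h0] using ((hc.sub continuous_const).norm (E := ℂ)).tendsto (w₀, (0 : ℝ≥0))
          (f := fun q : X × ℝ≥0 => ‖l q.1 q.2 - 1‖)
      exact this.eventually (gt_mem_nhds one_pos)
    rw [nhds_prod_eq, eventually_prod_iff] at h1
    obtain ⟨P, hP, Q, hQ, hPQ⟩ := h1
    obtain ⟨N, hN⟩ := eventually_atTop.1 (hpow.eventually hQ)
    exact ⟨N, hP.mono fun w hw m hm => re_pos_of_norm_sub_one_lt (hPQ hw (hN m hm))⟩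
  choose N hN using hN
  -- Candidate exponents at dyadic scales. Once the values stay in the half-plane, squaring commutes
  -- with the logarithm and `A w m` stops depending on `m`; hence the choice of `N w` does not spoil
  -- local regularity.
  let A : X → ℕ → ℂ := fun w m => -2 ^ m * Complex.log (l w (2 ^ m)⁻¹)
  have hstep : ∀ w m, 0 < (l w (2 ^ (m + 1))⁻¹).re → A w (m + 1) = A w m := by
    intro w m hm
    have h1 : ((2 : ℝ≥0) ^ m)⁻¹ = (2 ^ (m + 1))⁻¹ + (2 ^ (m + 1))⁻¹ := by
      rw [← two_mul, pow_succ, mul_inv]; field_simp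
    simp only [A]
    rw [h1, hadd, log_sq_of_re_pos hm]
    ring
  have hconst : ∀ w n, (∀ m ≥ n, 0 < (l w (2 ^ m)⁻¹).re) → ∀ m ≥ n, A w m = A w n := by
    intro w n h m hm
    induction m, hm using Nat.le_induction with
    | base => rfl
    | succ m hm ih => rw [hstep w m (h _ (by omega)), ih]
  let V : X → ℂ := fun w => A w (N w)
  have hself : ∀ w, ∀ m ≥ N w, 0 < (l w (2 ^ m)⁻¹).re := fun w => (hN w).self_of_nhds
  have hloc : ∀ w n, (∀ m ≥ n, 0 < (l w (2 ^ m)⁻¹).re) → V w = A w n := fun w n h => by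
    rw [← hconst w n h _ (le_max_left n (N w)), hconst w _ (hself w) _ (le_max_right n (N w))]
  have hdyad : ∀ w, ∀ m ≥ N w, l w (2 ^ m)⁻¹ = Complex.exp (-((2 : ℂ) ^ m)⁻¹ * V w) := by
    intro w m hm
    have hpos := hself w m hm
    have hne : l w (2 ^ m)⁻¹ ≠ 0 := by intro h; simp [h] at hpos
    rw [hloc w m fun j hj => hself w j (le_trans hm hj)]
    simp only [A]
    rw [show -((2 : ℂ) ^ m)⁻¹ * (-2 ^ m * Complex.log (l w (2 ^ m)⁻¹)) =
      Complex.log (l w (2 ^ m)⁻¹) by field_simp, Complex.exp_log hne]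
  have hmul : ∀ w (x : ℝ≥0) (n : ℕ), l w (n * x) = l w x ^ n := by
    intro w x n
    induction n with
    | zero => simp [h0]
    | succ n ih => rw [Nat.cast_succ, add_mul, one_mul, hadd, ih, pow_succ]
  refine ⟨V, fun w x => ?_, fun w₀ => ⟨N w₀, (hN w₀).mono fun w hw =>
    ⟨hw _ le_rfl, hloc w _ hw⟩⟩⟩
  -- The formula holds at dyadic rationals by taking powers, and at every `x` by continuity along
  -- these approximations.
  have hfloor : Tendsto (fun m : ℕ => (⌊(x : ℝ) * 2 ^ m⌋₊ : ℝ≥0) * (2 ^ m)⁻¹) atTop (𝓝 x) := by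
    rw [← NNReal.tendsto_coe]
    push_cast
    refine ((tendsto_nat_floor_mul_div_atTop (R := ℝ) x.2).comp
      (tendsto_pow_atTop_atTop_of_one_lt (one_lt_two (α := ℝ)))).congr fun m => ?_
    rw [Function.comp_apply, div_eq_mul_inv]
    rfl
  have hl : Tendsto (fun m : ℕ => l w (⌊(x : ℝ) * 2 ^ m⌋₊ * (2 ^ m)⁻¹)) atTop (𝓝 (l w x)) :=
    ((hc.comp (Continuous.prodMk_right w)).tendsto x).comp hfloor
  have hr : Tendsto (fun m : ℕ =>
      Complex.exp (-(((⌊(x : ℝ) * 2 ^ m⌋₊ * (2 ^ m)⁻¹ : ℝ≥0) : ℝ) : ℂ) * V w)) atTop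
      (𝓝 (Complex.exp (-(x : ℂ) * V w))) := by
    have hcr : Continuous fun y : ℝ≥0 => Complex.exp (-((y : ℝ) : ℂ) * V w) := by fun_prop
    exact (hcr.tendsto x).comp hfloor
  refine tendsto_nhds_unique (hl.congr' ?_) hr
  filter_upwards [eventually_ge_atTop (N w)] with m hm
  rw [hmul, hdyad w m hm, ← Complex.exp_nat_mul]
  congr 1
  push_cast
  ring

/-- A continuous family of branching laws has Laplace exponents in the right half-plane. -/
lemma IsBranchingKernelFamily.exists_exponent {k : TimePair → Kernel ℝ≥0∞ ℝ≥0∞}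
    (hk : IsBranchingKernelFamily k) :
    ∃ G : TimePair → ℂ → ℂ,
      (∀ p (x : ℝ≥0) ζ, ζ ∈ rightHalfPlane →
        laplace (k p x) ζ = Complex.exp (-(x : ℂ) * G p ζ)) ∧
      (∀ p, DifferentiableOn ℂ (G p) rightHalfPlane) ∧
      (Continuous fun q : TimePair × rightHalfPlane => G q.1 q.2) ∧
      ∀ p (θ : ℝ), 0 < θ → G p θ = (G p θ).re := by
  have := hk.markov
  have hc : Continuous fun q : (TimePair × rightHalfPlane) × ℝ≥0 =>
      laplace (k q.1.1 q.2) q.1.2 :=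
    continuous_laplace.comp (((hk.weakly_continuous.comp
      ((continuous_fst.comp continuous_fst).prodMk continuous_snd))).prodMk
      (continuous_snd.comp continuous_fst))
  obtain ⟨V, hV, hloc⟩ := exists_semigroup_exponent
    (l := fun (w : TimePair × rightHalfPlane) (x : ℝ≥0) => laplace (k w.1 x) w.2) hc
    (fun w => by rw [ENNReal.coe_zero, hk.zero_absorbing, laplace_dirac, laplaceKernel_zero_right])
    (fun w x y => by rw [ENNReal.coe_add, ← hk.branching, laplace_conv])
  let G : TimePair → ℂ → ℂ := fun p ζ =>
    open Classical in if h : ζ ∈ rightHalfPlane then V (p, ⟨ζ, h⟩) else 0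
  have hG : ∀ p (ζ : rightHalfPlane), G p ζ = V (p, ζ) := fun p ζ => dif_pos ζ.2
  refine ⟨G, fun p x ζ hζ => ?_, fun p ζ hζ => ?_, ?_, fun p θ hθ => ?_⟩
  · rw [hG p ⟨ζ, hζ⟩]
    exact hV (p, ⟨ζ, hζ⟩) x
  · obtain ⟨N, hN⟩ := hloc (p, ⟨ζ, hζ⟩)
    have h1 : ∀ᶠ z : rightHalfPlane in 𝓝 ⟨ζ, hζ⟩, 0 < (laplace (k p ((2 ^ N)⁻¹ : ℝ≥0)) z).re ∧
        V (p, z) = -2 ^ N * Complex.log (laplace (k p ((2 ^ N)⁻¹ : ℝ≥0)) z) :=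
      ((Continuous.prodMk_right p).tendsto (⟨ζ, hζ⟩ : rightHalfPlane)).eventually hN
    have h2 : G p =ᶠ[𝓝 ζ] fun z => -2 ^ N * Complex.log (laplace (k p ((2 ^ N)⁻¹ : ℝ≥0)) z) := by
      have h3 := map_nhds_subtype_coe_eq_nhds hζ (isOpen_rightHalfPlane.mem_nhds hζ)
      rw [EventuallyEq, ← h3, eventually_map]
      filter_upwards [h1] with z hz
      rw [hG, hz.2]
    have h4 : DifferentiableAt ℂ (laplace (k p ((2 ^ N)⁻¹ : ℝ≥0))) ζ :=
      (differentiableOn_laplace _).differentiableAt (isOpen_rightHalfPlane.mem_nhds hζ)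
    exact (((h4.clog (Or.inl h1.self_of_nhds.1)).const_mul _).congr_of_eventuallyEq
      h2).differentiableWithinAt
  · simp only [hG]
    rw [continuous_iff_continuousAt]
    intro w
    obtain ⟨N, hN⟩ := hloc w
    have h1 : ContinuousAt (fun w : TimePair × rightHalfPlane =>
        laplace (k w.1 ((2 ^ N)⁻¹ : ℝ≥0)) w.2) w :=
      (hc.comp (Continuous.prodMk_left ((2 ^ N)⁻¹ : ℝ≥0))).continuousAt
    exact ((h1.clog (Or.inl hN.self_of_nhds.1)).const_mul (-2 ^ N)).congr
      (hN.mono fun w hw => hw.2.symm)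
  -- At real `θ` the transform is a nonnegative real number, so its logarithm is real.
  · obtain ⟨N, hN⟩ := hloc (p, ⟨θ, ofReal_mem_rightHalfPlane hθ⟩)
    have h1 := hN.self_of_nhds.2
    rw [hG p ⟨θ, ofReal_mem_rightHalfPlane hθ⟩, h1]
    simp only [laplace_ofReal]
    rw [← Complex.ofReal_log (realLaplace_nonneg _ _)]
    norm_cast

lemma IsBernstein.monotoneOn {φ : ℝ → ℝ} (hφ : IsBernstein φ) : MonotoneOn φ (Ioi 0) := by
  refine monotoneOn_of_deriv_nonneg (convex_Ioi 0) hφ.smooth.continuousOn ?_ fun θ hθ => ?_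
  · rw [interior_Ioi]
    exact hφ.smooth.differentiableOn (by simp)
  · rw [interior_Ioi] at hθ
    simpa using hφ.deriv_sign 1 le_rfl θ hθ

/-- The identity theorem on the right half-plane. -/
lemma eqOn_rightHalfPlane_of_eqOn_Ioo {F G : ℂ → ℂ} (hF : DifferentiableOn ℂ F rightHalfPlane)
    (hG : DifferentiableOn ℂ G rightHalfPlane) {c : ℝ} (hc : 0 < c)
    (h : ∀ θ : ℝ, 0 < θ → θ < c → F θ = G θ) : EqOn F G rightHalfPlane := by
  have hconn : IsPreconnected rightHalfPlane := (convex_halfSpace_re_gt 0).isPreconnected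
  have hmem : ((c / 2 : ℝ) : ℂ) ∈ rightHalfPlane := ofReal_mem_rightHalfPlane (by positivity)
  refine (hF.analyticOnNhd isOpen_rightHalfPlane).eqOn_of_preconnected_of_frequently_eq
    (hG.analyticOnNhd isOpen_rightHalfPlane) hconn hmem ?_
  have ht : Tendsto (fun t : ℝ => (t : ℂ)) (𝓝[≠] (c / 2)) (𝓝[≠] ((c / 2 : ℝ) : ℂ)) :=
    Complex.continuous_ofReal.continuousWithinAt.tendsto_nhdsWithin
      fun t ht h => ht (Complex.ofReal_injective h)
  refine ht.frequently (Eventually.frequently ?_)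
  filter_upwards [mem_nhdsWithin_of_mem_nhds (Ioo_mem_nhds (half_pos hc) (half_lt_self hc))]
    with t ht using h t ht.1 ht.2

/-! ### Composition and positivity of Laplace exponents -/

section Exponents

variable {k : TimePair → Kernel ℝ≥0∞ ℝ≥0∞} {φ : TimePair → ℝ → ℝ}

/-- Smoothness comes from holomorphy, nonnegativity from the bound `1` on the transform, and the
derivative signs from complete monotonicity of the transforms for all `x > 0`. -/
lemma IsBranchingKernelFamily.isLaplaceExponent (hk : IsBranchingKernelFamily k) {p : TimePair}
    {F : ℂ → ℂ} (hF : DifferentiableOn ℂ F rightHalfPlane)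
    (hL : ∀ (x : ℝ≥0) ζ, ζ ∈ rightHalfPlane → laplace (k p x) ζ = Complex.exp (-(x : ℂ) * F ζ))
    (hre : ∀ θ : ℝ, 0 < θ → F θ = (F θ).re) :
    IsLaplaceExponent (k p) fun θ => (F θ).re := by
  have := hk.markov
  have hR : ∀ x θ : ℝ, 0 < x → 0 < θ →
      realLaplace (k p (ENNReal.ofReal x)) θ = Real.exp (-x * (F θ).re) := by
    intro x θ hx hθ
    have h := hL x.toNNReal θ (ofReal_mem_rightHalfPlane hθ)
    rw [hre θ hθ, laplace_ofReal, Real.coe_toNNReal x hx.le] at h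
    exact_mod_cast h
  refine ⟨IsBernstein.of_iteratedDeriv_exp_sign (contDiffOn_of_eqOn_ofReal hF hre)
    (fun θ hθ => ?_) fun x hx n θ hθ => ?_, hR⟩
  · have h := norm_laplace_le_one (k p (ENNReal.ofReal 1)) (ofReal_mem_rightHalfPlane hθ)
    rw [laplace_ofReal, hR 1 θ one_pos hθ, Complex.norm_real, Real.norm_eq_abs, Real.abs_exp,
      Real.exp_le_one_iff] at h
    linarith
  · have he : (fun t : ℝ => Real.exp (-x * (F t).re)) =ᶠ[𝓝 θ]
        realLaplace (k p (ENNReal.ofReal x)) := by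
      filter_upwards [isOpen_Ioi.mem_nhds hθ] with t ht using (hR x t hx ht).symm
    rw [he.iteratedDeriv_eq]
    exact iteratedDeriv_realLaplace_sign _ n hθ

lemma IsLaplaceExponent.eqOn {κ : Kernel ℝ≥0∞ ℝ≥0∞} {φ ψ : ℝ → ℝ} (hφ : IsLaplaceExponent κ φ)
    (hψ : IsLaplaceExponent κ ψ) : EqOn φ ψ (Ioi 0) := by
  intro θ hθ
  have h := Real.exp_injective
    ((hφ.laplace 1 θ one_pos hθ).symm.trans (hψ.laplace 1 θ one_pos hθ))
  linarith

lemma IsBranchingKernelFamily.exponent_refl (hk : IsBranchingKernelFamily k)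
    (hφ : ∀ p, IsLaplaceExponent (k p) (φ p)) (s : ℝ≥0) {θ : ℝ} (hθ : 0 < θ) :
    φ (TimePair.mk' s s le_rfl) θ = θ := by
  have h := (hφ (TimePair.mk' s s le_rfl)).laplace_eq (hk.zero_absorbing _) (hk.top_absorbing _)
    hθ (1 : ℝ≥0)
  rw [hk.refl, laplace_dirac, laplaceKernel_coe, laplaceKernel_coe] at h
  have h' : Real.exp (-θ) = Real.exp (-φ (TimePair.mk' s s le_rfl) θ) :=
    Complex.ofReal_injective (by simpa using h)
  linarith [Real.exp_injective h']

/-- Chapman–Kolmogorov read through transforms at `x = 1`. Positivity of the inner exponent is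
assumed because the outer formula is available only at positive arguments; it is established
afterwards, using this lemma. -/
lemma IsBranchingKernelFamily.exponent_comp (hk : IsBranchingKernelFamily k)
    (hφ : ∀ p, IsLaplaceExponent (k p) (φ p)) {s t u : ℝ≥0} (hst : s ≤ t) (htu : t ≤ u) {θ : ℝ}
    (hθ : 0 < θ) (hpos : 0 < φ (TimePair.mk' t u htu) θ) :
    φ (TimePair.mk' s u (hst.trans htu)) θ =
      φ (TimePair.mk' s t hst) (φ (TimePair.mk' t u htu) θ) := by
  have := hk.markov
  have hL : ∀ p (y : ℝ≥0∞) (θ : ℝ), 0 < θ → laplace (k p y) θ = laplaceKernel (φ p θ) y :=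
    fun p y θ hθ => (hφ p).laplace_eq (hk.zero_absorbing p) (hk.top_absorbing p) hθ y
  have h := laplace_comp (k (TimePair.mk' s t hst)) (k (TimePair.mk' t u htu)) (1 : ℝ≥0)
    (ofReal_mem_rightHalfPlane hθ)
  rw [hk.comp_eq hst htu] at h
  simp only [hL _ _ θ hθ] at h
  change _ = laplace _ _ at h
  rw [hL _ _ _ hpos, laplaceKernel_coe, laplaceKernel_coe] at h
  have h' : Real.exp (-φ (TimePair.mk' s u (hst.trans htu)) θ) =
      Real.exp (-φ (TimePair.mk' s t hst) (φ (TimePair.mk' t u htu) θ)) :=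
    Complex.ofReal_injective (by simpa using h)
  linarith [Real.exp_injective h']

/-- The Laplace exponents of a branching process do not vanish. -/
lemma IsBranchingKernelFamily.exponent_pos (hk : IsBranchingKernelFamily k)
    (hφ : ∀ p, IsLaplaceExponent (k p) (φ p))
    (hc : Continuous fun p => φ p 1)
    (hzero : ∀ p θ, 0 < θ → φ p θ = 0 → ∀ t, 0 < t → φ p t = 0)
    (p : TimePair) {θ : ℝ} (hθ : 0 < θ) : 0 < φ p θ := by
  refine lt_of_le_of_ne ((hφ p).bernstein.nonneg θ hθ) fun h => ?_
  obtain ⟨⟨s, u⟩, hsu⟩ := p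
  have hsu : s ≤ u := hsu
  -- Times at which the exponent started at `s` has degenerated. By `hzero`, vanishing at `1` is the
  -- same as vanishing identically, and by continuity a first such time exists.
  let Z : Set ℝ≥0 := {t | ∃ hst : s ≤ t, φ (TimePair.mk' s t hst) 1 = 0}
  have hZne : Z.Nonempty := ⟨u, hsu, hzero _ θ hθ h.symm 1 one_pos⟩
  have hZcl : IsClosed Z := by
    have h1 : IsClosed {t : Ici s | φ (TimePair.mk' s t t.2) 1 = 0} :=
      isClosed_eq (hc.comp (Continuous.subtype_mk (by fun_prop) _)) continuous_const
    convert isClosed_Ici.isClosedEmbedding_subtypeVal.isClosedMap _ h1 using 1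
    ext t
    simp [Z]
  obtain ⟨hs0, hz0⟩ : sInf Z ∈ Z := hZcl.csInf_mem hZne (OrderBot.bddBelow Z)
  set t₀ := sInf Z
  have hlt : s < t₀ := lt_of_le_of_ne hs0 fun h => by
    have h1 := hk.exponent_refl hφ s one_pos
    have h2 : TimePair.mk' s t₀ hs0 = TimePair.mk' s s le_rfl := Subtype.ext (Prod.ext rfl h.symm)
    rw [h2, h1] at hz0
    exact one_ne_zero hz0
  -- Were `φ_{t,t₀}(1)` positive, then `φ_{s,t₀} = φ_{s,t} ∘ φ_{t,t₀}` would force `φ_{s,t}` to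
  -- vanish, against minimality of `t₀`. Letting `t` increase to `t₀` then contradicts `φ_{t₀,t₀}(1)
  -- = 1`.
  have hbefore : ∀ t (ht : t ≤ t₀), s ≤ t → t < t₀ → φ (TimePair.mk' t t₀ ht) 1 = 0 := by
    intro t ht hst htt
    by_contra hne
    have hpos := lt_of_le_of_ne ((hφ (TimePair.mk' t t₀ ht)).bernstein.nonneg 1 one_pos)
      (Ne.symm hne)
    have h1 := hk.exponent_comp hφ hst ht one_pos hpos
    rw [hz0] at h1
    exact absurd (csInf_le (OrderBot.bddBelow Z) ⟨hst, hzero _ _ hpos h1.symm 1 one_pos⟩)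
      (not_le.2 htt)
  have h1 : IsClosed {t : Iic t₀ | φ (TimePair.mk' t t₀ t.2) 1 = 0} :=
    isClosed_eq (hc.comp (Continuous.subtype_mk (by fun_prop) _)) continuous_const
  have h2 := isClosed_Iic.isClosedEmbedding_subtypeVal.isClosedMap _ h1
  have h3 : Ico s t₀ ⊆ Subtype.val '' {t : Iic t₀ | φ (TimePair.mk' t t₀ t.2) 1 = 0} :=
    fun t ht => ⟨⟨t, ht.2.le⟩, hbefore t ht.2.le ht.1 ht.2, rfl⟩
  have h4 : t₀ ∈ closure (Ico s t₀) := by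
    rw [closure_Ico hlt.ne]; exact right_mem_Icc.2 hlt.le
  obtain ⟨⟨t, ht⟩, ht0, hte⟩ := closure_minimal h3 h2 h4
  change t = t₀ at hte
  subst hte
  have h5 := hk.exponent_refl hφ t₀ one_pos
  exact one_ne_zero (h5.symm.trans ht0)

end Exponents

/-- The Laplace exponents of a branching process form a topological reverse evolution family. -/
theorem IsBranchingKernelFamily.exists_isTopologicalREF {k : TimePair → Kernel ℝ≥0∞ ℝ≥0∞}
    (hk : IsBranchingKernelFamily k) {φ : TimePair → ℝ → ℝ}
    (hφ : ∀ p, IsLaplaceExponent (k p) (φ p)) :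
    ∃ v : TimePair → Hol rightHalfPlane rightHalfPlane,
      (∀ p, IsHolExtension (v p) (φ p)) ∧ (∀ p, v p ∈ BF) ∧ IsTopologicalREF v := by
  have := hk.markov
  obtain ⟨G, hL, hd, hc, hre⟩ := hk.exists_exponent
  have hGφ : ∀ p (θ : ℝ), 0 < θ → G p θ = φ p θ := fun p θ hθ => by
    rw [hre p θ hθ, ((hφ p).eqOn (hk.isLaplaceExponent (hd p) (hL p) (hre p)) hθ)]
  have hone : (1 : ℂ) ∈ rightHalfPlane := by simp [rightHalfPlane]
  have hpos : ∀ p θ, 0 < θ → 0 < φ p θ := by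
    refine fun p θ hθ => hk.exponent_pos hφ ?_ (fun p θ hθ h t ht => ?_) p hθ
    · have h1 := Complex.continuous_re.comp
        (hc.comp (Continuous.prodMk_left (⟨1, hone⟩ : rightHalfPlane)))
      refine h1.congr fun p => ?_
      have := hGφ p 1 one_pos
      rw [Complex.ofReal_one] at this
      simp [this]
    -- A zero at `θ` spreads to `(0, θ]` because `φ` is nonnegative and increasing, and then to the
    -- half-plane by the identity theorem.
    · have h1 : EqOn (G p) (fun _ => 0) rightHalfPlane :=
        eqOn_rightHalfPlane_of_eqOn_Ioo (hd p) (differentiableOn_const 0) hθ fun r hr hrθ => by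
          have h2 := (hφ p).bernstein.monotoneOn hr hθ hrθ.le
          rw [hGφ p r hr, le_antisymm (h2.trans h.le) ((hφ p).bernstein.nonneg r hr),
            Complex.ofReal_zero]
      have h2 := h1 (ofReal_mem_rightHalfPlane ht)
      rw [hGφ p t ht] at h2
      exact Complex.ofReal_injective h2
  -- The modulus of the transform at `ζ` is at most its value at `Re ζ`; with `x = 1` this reads `Re
  -- G(ζ) ≥ φ(Re ζ)`.
  have hmap : ∀ p ζ, ζ ∈ rightHalfPlane → G p ζ ∈ rightHalfPlane := by
    intro p ζ hζ
    have h1 := norm_laplace_le (k p (1 : ℝ≥0)) ζ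
    have h2 := (hφ p).laplace 1 ζ.re one_pos hζ
    rw [ENNReal.ofReal_one] at h2
    rw [hL p 1 ζ hζ, Complex.norm_exp, realLaplace, ENNReal.coe_one, h2, Real.exp_le_exp] at h1
    simp only [NNReal.coe_one, Complex.ofReal_one, neg_mul, one_mul, Complex.neg_re,
      neg_le_neg_iff] at h1
    exact (hpos p ζ.re hζ).trans_le h1
  have hcv : Continuous fun q : TimePair × rightHalfPlane =>
      (⟨G q.1 q.2, hmap q.1 q.2 q.2.2⟩ : rightHalfPlane) := hc.subtype_mk _
  let v : TimePair → Hol rightHalfPlane rightHalfPlane := fun p =>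
    ⟨⟨fun ζ => ⟨G p ζ, hmap p ζ ζ.2⟩, hcv.comp (Continuous.prodMk_right p)⟩,
      G p, hd p, fun _ => rfl⟩
  have hvφ : ∀ p, IsHolExtension (v p) (φ p) := fun p θ hθ => hGφ p θ hθ
  refine ⟨v, hvφ, fun p => ⟨φ p, (hφ p).bernstein, ⟨1, one_pos, (hpos p 1 one_pos).ne'⟩, hvφ p⟩,
    fun s ζ => ?_, fun s t u hst htu ζ => ?_, ?_⟩
  · refine Subtype.ext ?_
    refine eqOn_rightHalfPlane_of_eqOn_Ioo (hd _) differentiableOn_id one_pos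
      (fun θ hθ _ => ?_) ζ.2
    rw [hGφ _ θ hθ, hk.exponent_refl hφ s hθ, id]
  · refine Subtype.ext ?_
    refine eqOn_rightHalfPlane_of_eqOn_Ioo (hd _)
      ((hd (TimePair.mk' s t hst)).comp (hd (TimePair.mk' t u htu)) fun z hz => hmap _ z hz)
      one_pos (fun θ hθ _ => ?_) ζ.2
    rw [Function.comp_apply, hGφ _ θ hθ, hGφ _ θ hθ, hGφ _ _ (hpos _ θ hθ),
      hk.exponent_comp hφ hst htu hθ (hpos _ θ hθ)]
  · exact Continuous.subtype_mk (ContinuousMap.continuous_of_continuous_uncurry _ hcv) _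

end

theorem mainTheorem1 :
    (∀ k : TimePair → Kernel ℝ≥0∞ ℝ≥0∞, IsBranchingKernelFamily k →
      (∀ p : TimePair, ∃ φ : ℝ → ℝ, IsLaplaceExponent (k p) φ ∧
        ∀ ψ : ℝ → ℝ, IsLaplaceExponent (k p) ψ → Set.EqOn ψ φ (Set.Ioi 0)) ∧
      ∀ φ : TimePair → ℝ → ℝ, (∀ p : TimePair, IsLaplaceExponent (k p) (φ p)) →
        ∃ v : TimePair → Hol rightHalfPlane rightHalfPlane,
          (∀ p : TimePair, IsHolExtension (v p) (φ p)) ∧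
          (∀ p : TimePair, v p ∈ BF) ∧ IsTopologicalREF v) ∧
    (∀ v : TimePair → Hol rightHalfPlane rightHalfPlane,
      IsTopologicalREF v → (∀ p : TimePair, v p ∈ BF) →
        ∃! k : TimePair → Kernel ℝ≥0∞ ℝ≥0∞, IsBranchingKernelFamily k ∧
          ∀ p : TimePair, ∃ φ : ℝ → ℝ, IsHolExtension (v p) φ ∧ IsLaplaceExponent (k p) φ) := by
  refine ⟨fun k hk => ⟨fun p => ?_, fun φ hφ => hk.exists_isTopologicalREF hφ⟩, fun v hv hBF => ?_⟩
  · obtain ⟨G, hL, hd, -, hre⟩ := hk.exists_exponent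
    have h := hk.isLaplaceExponent (hd p) (hL p) (hre p)
    exact ⟨_, h, fun ψ hψ => hψ.eqOn h⟩
  · choose φ hφ _ hvφ using hBF
    obtain ⟨k, hk, hkφ⟩ := hv.exists_isBranchingKernelFamily hφ hvφ
    refine ⟨k, ⟨hk, fun p => ⟨φ p, hvφ p, hkφ p⟩⟩, fun k' ⟨hk', h⟩ => ?_⟩
    choose ψ hvψ hkψ using h
    exact hk'.ext hk hkψ hkφ fun p θ hθ => (hvψ p).eq_of_eq (hvφ p) hθ
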